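/- Let $\mathbb K$ be a field, $e\ge 1$, and let $X$ be a finite set, $R=\mathbb K[x : x\in X]$ with the standard grading and $\mathfrak m=(x : x\in X)$. Let $S_1,\dots,S_e\subseteq X$ be subsets with $|S_i|=n_i$, none contained in another one, whose union is $X$, and let $\Delta_{\mathbf r}$ be the simplicial complex on $X$ with facets $S_1,\dots,S_e$. Assume that it is obtained by sequential gluing along simplices: for every $m\in\{1,\dots,e-1\}$ the intersection of the subcomplex with facets $S_1,\dots,S_m$ and the full simplex on $S_{m+1}$ is a full simplex on $r_m\ge 0$ vertices. Put $N_{\mathbf r}=\sum_{i=1}^e n_i-\sum_{j=1}^{e-1} r_j$. Let $\Delta_{\mathbf r}^\vee=\{X\setminus F : F\subseteq X,\ F\notin\Delta_{\mathbf r}\}$ be the Alexander dual, and let $I_{\Delta_{\mathbf r}^\vee}\subseteq R$ be its Stanley–Reisner ideal, generated by the monomials $\prod_{x\in F}x$ of the minimal non-faces $F$ of $\Delta_{\mathbf r}^\vee$. Then for each $m\in\{1,\dots,e-1\}$ there is an index $p(m+1)$ with $1\le p(m+1)\le m$ and $$(S_1\cup\dots\cup S_m)\cap S_{m+1}\subseteq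 S_{p(m+1)}.$$ For every choice of such indices, $$0\longrightarrow\bigoplus_{m=1}^{e-1}R(-N_{\mathbf r}+r_m)\xrightarrow{\ \partial_2\ }\bigoplus_{m=1}^{e}R(-N_{\mathbf r}+n_m)\xrightarrow{\ \partial_1\ }I_{\Delta_{\mathbf r}^\vee}\longrightarrow 0$$ is a minimal graded free resolution of $I_{\Delta_{\mathbf r}^\vee}$ (an exact sequence of degree-preserving $R$-linear maps in which the image of $\partial_2$ lies in $\mathfrak m\cdot\bigoplus_{m=1}^{e}R(-N_{\mathbf r}+n_m)$), where 1. $\partial_1$ is the $1\times e$ matrix with entries $g_m=\prod_{x\in X\setminus S_m}x$, $m=1,\dots,e$; 2. $\partial_2$ is the $e\times(e-1)$ matrix with exactly two non-zero entries in each column $m\in\{1,\dots,e-1\}$, in the distinct rows $p(m+1)$ and $m+1$: $$(\partial_2)_{p(m+1),m}=\prod_{x\in S_{p(m+1)}\setminus S_{m+1}}x,\qquad(\partial_2)_{m+1,m}=-\prod_{x\in S_{m+1}\setminus S_{p(m+1)}}x.$$ -/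

import Mathlib

/-!
Simplicial complexes on the vertex set `V` are lower sets of `Finset V`. No condition on the vertices
is built in, since it can fail for an Alexander dual; the void complex `⊥` and the complex `{∅}` are
different. The simplices, indexed by `1, …, e` on paper, are indexed by `Fin (k + 1)` with `e = k + 1`:
for `m : Fin k`, `m.castSucc` is the index `m` and `m.succ` is the index `m + 1`.
-/

namespace GluedDual

section Complexes

variable {V : Type*}

/-- The full simplex on the vertex set `A`: all subsets of `A`. -/
def simplex (A : Finset V) : LowerSet (Finset V) := LowerSet.Iic A

/-- The complex whose faces are the sets contained in some `S i`. -/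
def complexOf {ι : Type*} (S : ι → Finset V) : LowerSet (Finset V) := ⨆ i, simplex (S i)

/-- The Alexander dual: the sets whose complement is not a face. -/
def alexanderDual [Fintype V] [DecidableEq V] (D : LowerSet (Finset V)) :
    LowerSet (Finset V) where
  carrier := {F | Fᶜ ∉ D}
  lower' := fun _ _ hBA hA hB => hA (D.lower (Finset.compl_subset_compl.2 hBA) hB)

/-- `complexOf S` is a glued complex `Δ_r(n_1, …, n_e)`: its facets are the distinct simplices `S i`
with `n i` vertices, every element of `V` is a vertex, and the intersection of the subcomplex
`⟨S_1, …, S_m⟩` with the simplex `⟨S_{m+1}⟩` is a simplex with `r m` vertices. -/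
structure IsGluing {k : ℕ} (n : Fin (k + 1) → ℕ) (r : Fin k → ℕ)
    (S : Fin (k + 1) → Finset V) : Prop where
  card_eq : ∀ i, (S i).card = n i
  glue : ∀ m : Fin k, ∃ A : Finset V, A.card = r m ∧
    (⨆ i ≤ m.castSucc, simplex (S i)) ⊓ simplex (S m.succ) = simplex A
  facet : ∀ i j, S i ⊆ S j → i = j
  vertex : ∀ x : V, {x} ∈ complexOf S

/-- The vertex set `(S_1 ∪ … ∪ S_m) ∩ S_{m+1}`. -/
def seqInter [DecidableEq V] {k : ℕ} (S : Fin (k + 1) → Finset V) (m : Fin k) : Finset V :=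
  (Finset.Iic m.castSucc).biUnion S ∩ S m.succ

/-- `p m` (written `p(m+1)` on paper) is an index `≤ m` such that
`(S_1 ∪ … ∪ S_m) ∩ S_{m+1} ⊆ S_{p(m+1)}`. -/
def IsParent [DecidableEq V] {k : ℕ} (S : Fin (k + 1) → Finset V)
    (p : Fin k → Fin (k + 1)) : Prop :=
  ∀ m, p m ≤ m.castSucc ∧ seqInter S m ⊆ S (p m)

/-- The number `N_r = ∑ n_i - ∑ r_j`. -/
def vertexCount {k : ℕ} (n : Fin (k + 1) → ℕ) (r : Fin k → ℕ) : ℤ :=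
  ∑ i, (n i : ℤ) - ∑ j, (r j : ℤ)

end Complexes

section Algebra

variable (K : Type*) [Field K] {V : Type*}

/-- The squarefree monomial `∏_{x ∈ F} x`. -/
noncomputable def sqfree (F : Finset V) : MvPolynomial V K := ∏ x ∈ F, MvPolynomial.X x

/-- The Stanley-Reisner ideal, generated by the monomials of the minimal non-faces. -/
noncomputable def stanleyReisner (D : LowerSet (Finset V)) : Ideal (MvPolynomial V K) :=
  Ideal.span {f | ∃ F : Finset V, Minimal (fun G => G ∉ D) F ∧ f = sqfree K F}

/-- The degree `d` part of the standard graded polynomial ring, for `d : ℤ`. -/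
noncomputable def degPart (V : Type*) (d : ℤ) : Submodule K (MvPolynomial V K) :=
  if 0 ≤ d then MvPolynomial.homogeneousSubmodule V K d.toNat else ⊥

/-- The degree `d` part of the graded free module `⨁ i, R(a i)`, where `R(a)_d = R_{a + d}`. -/
noncomputable def freePart {ι : Type*} (a : ι → ℤ) (d : ℤ) :
    Submodule K (ι → MvPolynomial V K) :=
  Submodule.pi Set.univ fun i => degPart K V (a i + d)

/-- The homogeneous maximal ideal, generated by the variables. -/
noncomputable def irrelevant (V : Type*) : Ideal (MvPolynomial V K) :=
  Ideal.span (Set.range MvPolynomial.X)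

variable {K}

/-- `0 → ⨁ j, R(b j) → ⨁ i, R(a i) → I → 0`, with maps `d₂` and `d₁`, is a minimal graded free
resolution of the ideal `I`: it is exact, both maps preserve degrees, and the image of the
differential `d₂` lies in `𝔪 · ⨁ i, R(a i)`. -/
structure IsMinimalFreeResolution {ι κ : Type*} (I : Ideal (MvPolynomial V K))
    (a : ι → ℤ) (b : κ → ℤ)
    (d₁ : (ι → MvPolynomial V K) →ₗ[MvPolynomial V K] I)
    (d₂ : (κ → MvPolynomial V K) →ₗ[MvPolynomial V K] (ι → MvPolynomial V K)) : Prop where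
  injective : Function.Injective d₂
  exact : Function.Exact d₂ d₁
  surjective : Function.Surjective d₁
  graded₁ : ∀ (d : ℤ) (v : ι → MvPolynomial V K), v ∈ freePart K a d →
    (d₁ v : MvPolynomial V K) ∈ degPart K V d
  graded₂ : ∀ (d : ℤ) (w : κ → MvPolynomial V K), w ∈ freePart K b d → d₂ w ∈ freePart K a d
  minimal : LinearMap.range d₂ ≤ irrelevant K V • ⊤

variable (K) [DecidableEq V]

/-- The `1 × e` matrix with entries `g_m = ∏_{x ∉ S_m} x`. -/
noncomputable def matrixOne [Fintype V] {k : ℕ} (S : Fin (k + 1) → Finset V) :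
    Matrix (Fin 1) (Fin (k + 1)) (MvPolynomial V K) :=
  fun _ m => sqfree K (S m)ᶜ

/-- The `e × (e - 1)` matrix whose column `m` has the entry `∏_{x ∈ S_{p(m+1)} \ S_{m+1}} x` in row
`p(m+1)`, the entry `-∏_{x ∈ S_{m+1} \ S_{p(m+1)}} x` in row `m + 1`, and zeros elsewhere. -/
noncomputable def matrixTwo {k : ℕ} (S : Fin (k + 1) → Finset V) (p : Fin k → Fin (k + 1)) :
    Matrix (Fin (k + 1)) (Fin k) (MvPolynomial V K) :=
  fun i m =>
    if i = p m then sqfree K (S (p m) \ S m.succ)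
    else if i = m.succ then -sqfree K (S m.succ \ S (p m))
    else 0

end Algebra

end GluedDual

namespace GluedDual

/-! ### Combinatorics of the gluing and the generators of the dual ideal. -/

section Combinatorics

variable {V : Type*}

/-! The ideal is generated by the `g_i`, the products of the variables outside `S_i`. With `p =
p(m+1)`, both terms of column `m` of `∂₁∂₂` are, up to opposite signs, the product of the variables
outside `S_p ∩ S_{m+1}`, so they cancel. Exactness is elimination from the last row
(`IsParent.mem_range_of_syzygy`). If a syzygy `v` vanishes beyond row `m+1`, each variable `x` of
`S_{m+1} \ S_p` lies outside all earlier `S_i`, hence divides the earlier `g_i` and so `g_{m+1}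
v_{m+1}`. It is prime and does not divide `g_{m+1}`, so it divides `v_{m+1}`, and a multiple of
column `m` clears that entry. Injectivity is the triangular shape of `∂₂`; minimality holds because
no facet contains another; the degrees match because `N_r` is the number of vertices. -/

lemma mem_simplex {A F : Finset V} : F ∈ simplex A ↔ F ⊆ A := Iff.rfl

lemma mem_complexOf {ι : Type*} {S : ι → Finset V} {F : Finset V} :
    F ∈ complexOf S ↔ ∃ i, F ⊆ S i := by
  simp [complexOf, LowerSet.mem_iSup_iff, mem_simplex]

variable [DecidableEq V] {k : ℕ} {n : Fin (k + 1) → ℕ} {r : Fin k → ℕ}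
  {S : Fin (k + 1) → Finset V}

lemma mem_seqInter {m : Fin k} {x : V} :
    x ∈ seqInter S m ↔ (∃ i ≤ m.castSucc, x ∈ S i) ∧ x ∈ S m.succ := by
  simp [seqInter]

/-- The simplex along which `S m.succ` is glued has the vertex set `seqInter S m`. -/
lemma IsGluing.seqInter_spec (hS : IsGluing n r S) (m : Fin k) :
    (seqInter S m).card = r m ∧ ∃ i ≤ m.castSucc, seqInter S m ⊆ S i := by
  obtain ⟨A, hA, hglue⟩ := hS.glue m
  -- Comparing faces suffices: taking `A` itself as a face produces the index `i`, and taking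
  -- singletons identifies `A` with `seqInter S m`.
  have key : ∀ F, ((∃ i ≤ m.castSucc, F ⊆ S i) ∧ F ⊆ S m.succ) ↔ F ⊆ A := fun F => by
    rw [← mem_simplex (A := A), ← hglue]
    simp [LowerSet.mem_iSup_iff, mem_simplex]
  obtain ⟨⟨i, hi, hAi⟩, hAm⟩ := (key A).2 subset_rfl
  have hEq : seqInter S m = A := by
    ext x
    rw [mem_seqInter, ← Finset.singleton_subset_iff (s := A), ← key]
    simp
  exact ⟨hEq ▸ hA, i, hi, hEq ▸ hAi⟩

lemma IsGluing.exists_isParent (hS : IsGluing n r S) : ∃ p, IsParent S p := by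
  choose p hp using fun m => (hS.seqInter_spec m).2
  exact ⟨p, hp⟩

lemma IsParent.inter_eq {p : Fin k → Fin (k + 1)} (hp : IsParent S p) (m : Fin k) :
    S (p m) ∩ S m.succ = seqInter S m := by
  ext x
  rw [Finset.mem_inter]
  refine ⟨fun h => mem_seqInter.2 ⟨⟨_, (hp m).1, h.1⟩, h.2⟩, fun h => ⟨(hp m).2 h, ?_⟩⟩
  exact (mem_seqInter.1 h).2

lemma IsParent.ne_succ {p : Fin k → Fin (k + 1)} (hp : IsParent S p) (m : Fin k) :
    p m ≠ m.succ :=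
  ((hp m).1.trans_lt Fin.castSucc_lt_succ).ne

lemma IsParent.notMem_of_mem_sdiff {p : Fin k → Fin (k + 1)} (hp : IsParent S p) {m : Fin k}
    {x : V} (hx : x ∈ S m.succ \ S (p m)) {i : Fin (k + 1)} (hi : i ≤ m.castSucc) : x ∉ S i := by
  rw [Finset.mem_sdiff] at hx
  exact fun h => hx.2 ((hp m).2 (mem_seqInter.2 ⟨⟨i, hi, h⟩, hx.1⟩))

/-- Inclusion-exclusion along a sequence of finite sets. -/
lemma card_biUnion_add_sum_seqInter :
    ∀ {k : ℕ} (S : Fin (k + 1) → Finset V),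
      (Finset.univ.biUnion S).card + ∑ m, (seqInter S m).card = ∑ i, (S i).card
  | 0, S => by simp
  | k + 1, S => by
    have ih := card_biUnion_add_sum_seqInter (fun i : Fin (k + 1) => S i.castSucc)
    have h1 : Finset.univ.biUnion S =
        Finset.univ.biUnion (fun i : Fin (k + 1) => S i.castSucc) ∪ S (Fin.last _) := by
      ext x
      simp only [Finset.mem_biUnion, Finset.mem_univ, true_and, Finset.mem_union]
      constructor
      · rintro ⟨i, hi⟩
        induction i using Fin.lastCases with
        | last => exact Or.inr hi
        | cast i => exact Or.inl ⟨i, hi⟩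
      · rintro (⟨i, hi⟩ | hi)
        exacts [⟨_, hi⟩, ⟨_, hi⟩]
    have h2 : seqInter S (Fin.last k) =
        Finset.univ.biUnion (fun i : Fin (k + 1) => S i.castSucc) ∩ S (Fin.last _) := by
      ext x
      simp only [mem_seqInter, Finset.mem_inter, Finset.mem_biUnion, Finset.mem_univ, true_and,
        Fin.succ_last]
      refine and_congr_left fun _ => ⟨?_, ?_⟩
      · rintro ⟨i, hi, hx⟩
        exact ⟨i.castPred (hi.trans_lt (Fin.castSucc_lt_last _)).ne, by simpa using hx⟩
      · rintro ⟨i, hx⟩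
        exact ⟨_, Fin.castSucc_le_castSucc_iff.2 (Fin.le_last i), hx⟩
    have h3 : ∀ m : Fin k,
        seqInter (fun i : Fin (k + 1) => S i.castSucc) m = seqInter S m.castSucc := fun m => by
      ext x
      simp only [mem_seqInter, Fin.succ_castSucc]
      refine and_congr_left fun _ => ⟨?_, ?_⟩
      · rintro ⟨i, hi, hx⟩
        exact ⟨_, Fin.castSucc_le_castSucc_iff.2 hi, hx⟩
      · rintro ⟨i, hi, hx⟩
        refine ⟨i.castPred (hi.trans_lt (Fin.castSucc_lt_last _)).ne, ?_, by simpa using hx⟩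
        rwa [← Fin.castSucc_le_castSucc_iff, Fin.castSucc_castPred]
    simp only [h3] at ih
    rw [Fin.sum_univ_castSucc (fun m => (seqInter S m).card),
      Fin.sum_univ_castSucc (fun i => (S i).card), h1, h2, ← ih]
    have := Finset.card_union_add_card_inter
      (Finset.univ.biUnion (fun i : Fin (k + 1) => S i.castSucc)) (S (Fin.last _))
    omega

/-- Identifies the shift `n_i - N_r` with minus the degree of `g_i`. -/
lemma IsGluing.vertexCount_eq [Fintype V] (hS : IsGluing n r S) :
    vertexCount n r = Fintype.card V := by
  have h := card_biUnion_add_sum_seqInter S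
  have hU : Finset.univ.biUnion S = Finset.univ := by
    ext x
    simpa using mem_complexOf.1 (hS.vertex x)
  simp only [hU, Finset.card_univ, (hS.seqInter_spec _).1, hS.card_eq] at h
  have h' := congrArg (Nat.cast : ℕ → ℤ) h
  push_cast at h'
  rw [vertexCount, ← h']
  ring

/-- The minimal non-faces of the Alexander dual are the complements of the facets. -/
lemma IsGluing.minimal_notMem_alexanderDual [Fintype V] (hS : IsGluing n r S) (F : Finset V) :
    Minimal (fun G => G ∉ alexanderDual (complexOf S)) F ↔ ∃ i, F = (S i)ᶜ := by
  have key : ∀ G, G ∉ alexanderDual (complexOf S) ↔ ∃ i, (S i)ᶜ ⊆ G := fun G => by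
    have : G ∈ alexanderDual (complexOf S) ↔ Gᶜ ∉ complexOf S := Iff.rfl
    rw [this, not_not, mem_complexOf]
    exact exists_congr fun i => compl_le_iff_compl_le
  simp only [key]
  constructor
  · rintro ⟨⟨i, hi⟩, hmin⟩
    exact ⟨i, (hmin ⟨i, subset_rfl⟩ hi).antisymm hi⟩
  · rintro ⟨i, rfl⟩
    refine ⟨⟨i, subset_rfl⟩, ?_⟩
    rintro G ⟨j, hj⟩ hG
    rwa [hS.facet i j (Finset.compl_subset_compl.1 (hj.trans hG))]

end Combinatorics

/-! ### Divisibility and degrees of squarefree monomials. -/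

section Monomials

variable {K : Type*} [Field K] {V : Type*}

lemma sqfree_ne_zero (F : Finset V) : sqfree K F ≠ 0 :=
  Finset.prod_ne_zero_iff.2 fun x _ => MvPolynomial.X_ne_zero x

lemma sqfree_mem_irrelevant {F : Finset V} (hF : F.Nonempty) : sqfree K F ∈ irrelevant K V := by
  obtain ⟨x, hx⟩ := hF
  exact Ideal.mem_of_dvd _ (Finset.dvd_prod_of_mem _ hx) (Ideal.subset_span ⟨x, rfl⟩)

lemma not_X_dvd_sqfree {F : Finset V} {x : V} (hx : x ∉ F) :
    ¬ (MvPolynomial.X x : MvPolynomial V K) ∣ sqfree K F := by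
  rw [sqfree, (MvPolynomial.X_prime (R := K)).dvd_finsetProd_iff]
  rintro ⟨y, hy, hxy⟩
  rw [MvPolynomial.X_dvd_X] at hxy
  simp_all

/-- Distinct variables are non-associated primes, hence relatively prime. -/
lemma sqfree_dvd {F : Finset V} {f : MvPolynomial V K}
    (h : ∀ x ∈ F, (MvPolynomial.X x : MvPolynomial V K) ∣ f) : sqfree K F ∣ f := by
  refine Finset.prod_dvd_of_isRelPrime (fun x _ y _ hxy => ?_) h
  refine (MvPolynomial.X_prime (R := K)).irreducible.isRelPrime_iff_not_dvd.2 fun hd => hxy ?_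
  rw [MvPolynomial.X_dvd_X] at hd
  simp_all

/-- The right side is symmetric in `A` and `B`; this is why the columns of `∂₂` are syzygies. -/
lemma sqfree_compl_mul_sqfree_sdiff [Fintype V] [DecidableEq V] (A B : Finset V) :
    sqfree K Aᶜ * sqfree K (A \ B) = sqfree K (A ∩ B)ᶜ := by
  rw [sqfree, sqfree, sqfree, ← Finset.prod_union]
  · congr 1
    ext x
    simp only [Finset.mem_union, Finset.mem_compl, Finset.mem_sdiff, Finset.mem_inter]
    tauto
  · exact disjoint_compl_left.mono_right Finset.sdiff_subset

lemma sqfree_mul_mem_degPart {F : Finset V} {f : MvPolynomial V K} {c d : ℤ}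
    (hf : f ∈ degPart K V c) (hcd : c + F.card = d) : sqfree K F * f ∈ degPart K V d := by
  subst hcd
  unfold degPart at hf ⊢
  split_ifs at hf with hc
  · rw [if_pos (by positivity)]
    rw [MvPolynomial.mem_homogeneousSubmodule] at hf ⊢
    have hF : (sqfree K F).IsHomogeneous F.card := by
      simpa [sqfree] using MvPolynomial.IsHomogeneous.prod F (fun x => (MvPolynomial.X x : MvPolynomial V K))
        (fun _ => 1) fun x _ => MvPolynomial.isHomogeneous_X K x
    have := hF.mul hf
    rwa [show (c + F.card).toNat = F.card + c.toNat by omega]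
  -- For `c < 0` the graded piece is zero, whatever the sign of `d`.
  · rw [(Submodule.mem_bot K).1 hf, mul_zero]
    exact Submodule.zero_mem _

end Monomials

lemma mem_ideal_smul_top_pi {R ι : Type*} [CommRing R] [Finite ι] {I : Ideal R} {v : ι → R}
    (h : ∀ i, v i ∈ I) : v ∈ (I • ⊤ : Submodule R (ι → R)) := by
  classical
  cases nonempty_fintype ι
  rw [pi_eq_sum_univ v]
  exact Submodule.sum_mem _ fun i _ => Submodule.smul_mem_smul (h i) trivial

/-! ### The map `∂₂`: injectivity, minimality and degrees. -/

section Resolution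

variable {K : Type*} [Field K] {V : Type*} [DecidableEq V] {k : ℕ}
  {n : Fin (k + 1) → ℕ} {r : Fin k → ℕ} {S : Fin (k + 1) → Finset V}
  {p : Fin k → Fin (k + 1)}

lemma matrixTwo_parent (m : Fin k) :
    matrixTwo K S p (p m) m = sqfree K (S (p m) \ S m.succ) := if_pos rfl

lemma IsParent.matrixTwo_succ (hp : IsParent S p) (m : Fin k) :
    matrixTwo K S p m.succ m = -sqfree K (S m.succ \ S (p m)) := by
  rw [matrixTwo, if_neg (hp.ne_succ m).symm, if_pos rfl]

lemma matrixTwo_of_ne {i : Fin (k + 1)} {m : Fin k} (h₁ : i ≠ p m) (h₂ : i ≠ m.succ) :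
    matrixTwo K S p i m = 0 := by
  rw [matrixTwo, if_neg h₁, if_neg h₂]

lemma IsParent.matrixTwo_ne_zero_iff (hp : IsParent S p) (i : Fin (k + 1)) (m : Fin k) :
    matrixTwo K S p i m ≠ 0 ↔ i = p m ∨ i = m.succ := by
  constructor
  · contrapose!
    exact fun h => matrixTwo_of_ne h.1 h.2
  · rintro (rfl | rfl)
    · rw [matrixTwo_parent]
      exact sqfree_ne_zero _
    · rw [hp.matrixTwo_succ]
      exact neg_ne_zero.2 (sqfree_ne_zero _)

/-- The column `m` vanishes below the row `m.succ`. -/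
lemma IsParent.matrixTwo_of_lt (hp : IsParent S p) {i : Fin (k + 1)} {m : Fin k}
    (h : m.succ < i) : matrixTwo K S p i m = 0 :=
  matrixTwo_of_ne (((hp m).1.trans_lt Fin.castSucc_lt_succ).trans h).ne' h.ne'

lemma IsParent.mulVecLin_injective (hp : IsParent S p) :
    Function.Injective (matrixTwo K S p).mulVecLin := by
  rw [← LinearMap.ker_eq_bot, LinearMap.ker_eq_bot']
  intro w hw
  by_contra hne
  obtain ⟨j, hj⟩ := Function.ne_iff.1 hne
  classical
  -- For the last index `m` with `w m ≠ 0`, only column `m` contributes to row `m.succ`: earlier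
  -- columns vanish there and later coefficients are zero.
  obtain ⟨m, hm, hmax⟩ := (Finset.univ.filter fun m => w m ≠ 0).exists_max_image id ⟨j, by simpa⟩
  have hm0 : w m ≠ 0 := by simpa using hm
  have hz : ∀ j, m < j → w j = 0 := fun j hj => by
    by_contra h
    exact hj.not_ge (hmax j (by simpa using h))
  have hrow := congrFun hw m.succ
  rw [Matrix.mulVecLin_apply, Matrix.mulVec, dotProduct, Finset.sum_eq_single m] at hrow
  · rw [hp.matrixTwo_succ] at hrow
    exact mul_ne_zero (neg_ne_zero.2 (sqfree_ne_zero _)) hm0 hrow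
  · intro j _ hjm
    rcases lt_or_gt_of_ne hjm with h | h
    · rw [hp.matrixTwo_of_lt (Fin.succ_lt_succ_iff.2 h), zero_mul]
    · rw [hz j h, mul_zero]
  · simp

lemma IsGluing.range_mulVecLin_le (hS : IsGluing n r S) (hp : IsParent S p) :
    LinearMap.range (matrixTwo K S p).mulVecLin ≤ irrelevant K V • ⊤ := by
  have hne : ∀ i j, i ≠ j → (S i \ S j).Nonempty := fun i j hij =>
    Finset.sdiff_nonempty.2 fun h => hij (hS.facet i j h)
  rintro _ ⟨w, rfl⟩
  refine mem_ideal_smul_top_pi fun i => ?_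
  rw [Matrix.mulVecLin_apply, Matrix.mulVec, dotProduct]
  refine Ideal.sum_mem _ fun m _ => Ideal.mul_mem_right _ _ ?_
  by_cases h : matrixTwo K S p i m = 0
  · rw [h]
    exact Ideal.zero_mem _
  · rcases (hp.matrixTwo_ne_zero_iff i m).1 h with rfl | rfl
    · rw [matrixTwo_parent]
      exact sqfree_mem_irrelevant (hne _ _ (hp.ne_succ m))
    · rw [hp.matrixTwo_succ]
      exact neg_mem (sqfree_mem_irrelevant (hne _ _ (hp.ne_succ m).symm))

lemma IsGluing.card_sdiff (hS : IsGluing n r S) (hp : IsParent S p) (m : Fin k) :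
    ((S (p m) \ S m.succ).card : ℤ) = n (p m) - r m ∧
      ((S m.succ \ S (p m)).card : ℤ) = n m.succ - r m := by
  have h₁ := Finset.card_sdiff_add_card_inter (S (p m)) (S m.succ)
  have h₂ := Finset.card_sdiff_add_card_inter (S m.succ) (S (p m))
  rw [Finset.inter_comm] at h₂
  rw [hp.inter_eq, (hS.seqInter_spec m).1, hS.card_eq] at h₁ h₂
  omega

lemma IsGluing.mulVecLin_mem_freePart (hS : IsGluing n r S) (hp : IsParent S p) (c d : ℤ)
    {w : Fin k → MvPolynomial V K} (hw : w ∈ freePart K (fun m => c + (r m : ℤ)) d) :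
    (matrixTwo K S p).mulVecLin w ∈ freePart K (fun i => c + (n i : ℤ)) d := by
  intro i _
  rw [Matrix.mulVecLin_apply, Matrix.mulVec, dotProduct]
  refine Submodule.sum_mem _ fun m _ => ?_
  have hm : w m ∈ degPart K V (c + r m + d) := hw m trivial
  have hc := hS.card_sdiff hp m
  by_cases h : matrixTwo K S p i m = 0
  · rw [h, zero_mul]
    exact Submodule.zero_mem _
  · rcases (hp.matrixTwo_ne_zero_iff i m).1 h with rfl | rfl
    · rw [matrixTwo_parent]
      exact sqfree_mul_mem_degPart hm (by rw [hc.1]; ring)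
    · rw [hp.matrixTwo_succ, neg_mul]
      exact neg_mem (sqfree_mul_mem_degPart hm (by rw [hc.2]; ring))

/-! ### The map `∂₁` and exactness. -/

variable [Fintype V]

lemma matrixOne_mulVec (v : Fin (k + 1) → MvPolynomial V K) :
    (matrixOne K S).mulVec v 0 = ∑ i, sqfree K (S i)ᶜ * v i := rfl

lemma IsParent.matrixOne_mul_matrixTwo (hp : IsParent S p) :
    matrixOne K S * matrixTwo K S p = 0 := by
  ext1 a m
  rw [Matrix.mul_apply, Finset.sum_eq_add (p m) m.succ (hp.ne_succ m), matrixTwo_parent,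
    hp.matrixTwo_succ, mul_neg, matrixOne, matrixOne, sqfree_compl_mul_sqfree_sdiff,
    sqfree_compl_mul_sqfree_sdiff, Finset.inter_comm, add_neg_cancel, Matrix.zero_apply]
  · intro i _ hi
    rw [matrixTwo_of_ne hi.1 hi.2, mul_zero]
  · simp
  · simp

lemma IsParent.matrixOne_mulVec_matrixTwo (hp : IsParent S p) (w : Fin k → MvPolynomial V K) :
    (matrixOne K S).mulVec ((matrixTwo K S p).mulVec w) 0 = 0 := by
  rw [Matrix.mulVec_mulVec, hp.matrixOne_mul_matrixTwo, Matrix.zero_mulVec, Pi.zero_apply]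

/-- The leading coefficient of a syzygy supported on `S_1, …, S_{m+1}` is divisible by
`∏_{x ∈ S_{m+1} \ S_{p(m+1)}} x`. -/
lemma IsParent.sqfree_dvd_of_syzygy (hp : IsParent S p) {m : Fin k}
    {v : Fin (k + 1) → MvPolynomial V K} (hv : (matrixOne K S).mulVec v 0 = 0)
    (hz : ∀ i, m.succ < i → v i = 0) : sqfree K (S m.succ \ S (p m)) ∣ v m.succ := by
  refine sqfree_dvd fun x hx => ?_
  have hd : (MvPolynomial.X x : MvPolynomial V K) ∣ sqfree K (S m.succ)ᶜ * v m.succ := by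
    rw [matrixOne_mulVec, ← Finset.add_sum_erase _ _ (Finset.mem_univ m.succ)] at hv
    rw [eq_neg_of_add_eq_zero_left hv, dvd_neg]
    refine Finset.dvd_sum fun i hi => ?_
    rcases lt_or_gt_of_ne (Finset.ne_of_mem_erase hi) with h | h
    · have hxi := hp.notMem_of_mem_sdiff hx (Fin.le_castSucc_iff.2 h)
      exact (Finset.dvd_prod_of_mem _ (Finset.mem_compl.2 hxi)).mul_right _
    · simp [hz i h]
  refine ((MvPolynomial.X_prime (R := K)).dvd_or_dvd hd).resolve_left (not_X_dvd_sqfree ?_)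
  simpa using (Finset.mem_sdiff.1 hx).1

/-- Induction on a bound `t` for the support of the syzygy; for `t = 0` the relation is `g_1 v_1 =
0` in a domain. -/
lemma IsParent.mem_range_of_syzygy (hp : IsParent S p) (t : Fin (k + 1)) :
    ∀ v : Fin (k + 1) → MvPolynomial V K, (matrixOne K S).mulVec v 0 = 0 →
      (∀ i, t < i → v i = 0) → v ∈ LinearMap.range (matrixTwo K S p).mulVecLin := by
  induction t using Fin.induction with
  | zero =>
    intro v hv hz
    have hv0 : v 0 = 0 := by
      rw [matrixOne_mulVec, Finset.sum_eq_single 0 (fun i _ hi => by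
        rw [hz i (Fin.pos_of_ne_zero hi), mul_zero]) (by simp)] at hv
      exact (mul_eq_zero.1 hv).resolve_left (sqfree_ne_zero _)
    have : v = 0 := funext fun i => by
      rcases eq_or_ne i 0 with rfl | hi
      · exact hv0
      · exact hz i (Fin.pos_of_ne_zero hi)
    rw [this]
    exact Submodule.zero_mem _
  | succ m ih =>
    intro v hv hz
    obtain ⟨q, hq⟩ := hp.sqfree_dvd_of_syzygy hv hz
    have hcol : ∀ i, (matrixTwo K S p).mulVec (Pi.single m q) i = matrixTwo K S p i m * q :=
      fun i => by simp [Matrix.mulVec_single]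
    -- The column is added, not subtracted, because its entry in row `m.succ` carries a minus sign.
    have := ih (v + (matrixTwo K S p).mulVec (Pi.single m q)) (by
      rw [Matrix.mulVec_add, Pi.add_apply, hv, hp.matrixOne_mulVec_matrixTwo, add_zero]) (by
      intro i hi
      rw [Pi.add_apply, hcol]
      rcases (Fin.castSucc_lt_iff_succ_le.1 hi).eq_or_lt with rfl | h
      · rw [hp.matrixTwo_succ, hq, neg_mul, add_neg_cancel]
      · rw [hp.matrixTwo_of_lt h, hz i h, zero_mul, add_zero])
    rwa [Submodule.add_mem_iff_left] at this
    exact ⟨Pi.single m q, rfl⟩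

lemma IsParent.matrixOne_mulVec_eq_zero_iff (hp : IsParent S p)
    (v : Fin (k + 1) → MvPolynomial V K) :
    (matrixOne K S).mulVec v 0 = 0 ↔ v ∈ Set.range (matrixTwo K S p).mulVecLin := by
  constructor
  · exact fun hv => hp.mem_range_of_syzygy (Fin.last k) v hv
      fun i hi => absurd hi (Fin.le_last i).not_gt
  · rintro ⟨w, rfl⟩
    exact hp.matrixOne_mulVec_matrixTwo w

lemma IsGluing.stanleyReisner_eq (hS : IsGluing n r S) :
    stanleyReisner K (alexanderDual (complexOf S)) =
      Ideal.span (Set.range fun i => sqfree K (S i)ᶜ) := by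
  rw [stanleyReisner]
  congr 1
  ext f
  simp only [hS.minimal_notMem_alexanderDual, Set.mem_ofPred_eq, Set.mem_range]
  constructor
  · rintro ⟨_, ⟨i, rfl⟩, rfl⟩
    exact ⟨i, rfl⟩
  · rintro ⟨i, rfl⟩
    exact ⟨_, ⟨i, rfl⟩, rfl⟩

lemma IsGluing.mem_stanleyReisner_iff (hS : IsGluing n r S) (f : MvPolynomial V K) :
    f ∈ stanleyReisner K (alexanderDual (complexOf S)) ↔
      ∃ v, (matrixOne K S).mulVec v 0 = f := by
  rw [hS.stanleyReisner_eq, Ideal.mem_span_range_iff_exists_fun]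
  simp only [matrixOne_mulVec, mul_comm]

lemma IsGluing.matrixOne_mulVec_mem_degPart (hS : IsGluing n r S) {d : ℤ}
    {v : Fin (k + 1) → MvPolynomial V K}
    (hv : v ∈ freePart K (fun i => -vertexCount n r + (n i : ℤ)) d) :
    (matrixOne K S).mulVec v 0 ∈ degPart K V d := by
  rw [matrixOne_mulVec]
  refine Submodule.sum_mem _ fun i _ => sqfree_mul_mem_degPart (hv i trivial) ?_
  have := Finset.card_add_card_compl (S i)
  rw [hS.card_eq] at this
  rw [hS.vertexCount_eq, ← this]
  push_cast
  ring

end Resolution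

end GluedDual

theorem mainTheorem5 {K : Type*} [Field K] {V : Type*} [Fintype V] [DecidableEq V] {k : ℕ}
    (n : Fin (k + 1) → ℕ) (r : Fin k → ℕ) (S : Fin (k + 1) → Finset V)
    (hS : GluedDual.IsGluing n r S) :
    (∃ p : Fin k → Fin (k + 1), GluedDual.IsParent S p) ∧
    ∀ p : Fin k → Fin (k + 1), GluedDual.IsParent S p →
      (∀ m : Fin k, p m ≠ m.succ ∧
        GluedDual.matrixTwo K S p (p m) m = GluedDual.sqfree K (S (p m) \ S m.succ) ∧
        GluedDual.matrixTwo K S p m.succ m = -GluedDual.sqfree K (S m.succ \ S (p m)) ∧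
        ∀ i, GluedDual.matrixTwo K S p i m ≠ 0 ↔ i = p m ∨ i = m.succ) ∧
      ∃ d₁ : (Fin (k + 1) → MvPolynomial V K) →ₗ[MvPolynomial V K]
          GluedDual.stanleyReisner K (GluedDual.alexanderDual (GluedDual.complexOf S)),
        (∀ v, (d₁ v : MvPolynomial V K) = (GluedDual.matrixOne K S).mulVec v 0) ∧
        GluedDual.IsMinimalFreeResolution
          (GluedDual.stanleyReisner K (GluedDual.alexanderDual (GluedDual.complexOf S)))
          (fun m => -GluedDual.vertexCount n r + (n m : ℤ))
          (fun m => -GluedDual.vertexCount n r + (r m : ℤ))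
          d₁ (GluedDual.matrixTwo K S p).mulVecLin := by
  refine ⟨hS.exists_isParent, fun p hp => ⟨fun m => ⟨hp.ne_succ m, GluedDual.matrixTwo_parent m,
    hp.matrixTwo_succ m, fun i => hp.matrixTwo_ne_zero_iff i m⟩, ?_⟩⟩
  refine ⟨LinearMap.codRestrict _ (LinearMap.proj 0 ∘ₗ (GluedDual.matrixOne K S).mulVecLin)
    fun v => (hS.mem_stanleyReisner_iff _).2 ⟨v, rfl⟩, fun v => rfl, ?_⟩
  exact
    { injective := hp.mulVecLin_injective
      exact := fun v => by
        rw [← hp.matrixOne_mulVec_eq_zero_iff, ← Subtype.coe_inj]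
        rfl
      surjective := fun f => by
        obtain ⟨v, hv⟩ := (hS.mem_stanleyReisner_iff f.1).1 f.2
        exact ⟨v, Subtype.ext hv⟩
      graded₁ := fun d v hv => hS.matrixOne_mulVec_mem_degPart hv
      graded₂ := fun d w hw => hS.mulVecLin_mem_freePart hp _ d hw
      minimal := hS.range_mulVecLin_le hp }
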